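/- Let $0\le p<1$, $\sigma>0$, and let $f$ be a probability density on $\mathbb R$ with characteristic function $\phi_f(t)=\int e^{itx}f(x)\,dx$. Let $X_1,X_2,\dots$ be i.i.d. random variables, $X_i=Y_i+\sigma Z_i$, where $Z_i$ is standard normal and independent of $Y_i=U_iV_i$, and where $U_i$ and $V_i$ are independent, $P(U_i=0)=p$, $P(U_i=1)=1-p$, and $V_i$ has density $f$. Assume that $\phi_f$ is integrable and that $E[X_1^2]<\infty$. Let $k$ be a real-valued square-integrable kernel with Fourier transform $\phi_k(t)=\int e^{itx}k(x)\,dx$ (in the $L^2$ sense), and assume that $\phi_k$ vanishes outside $[-1,1]$, is bounded, and satisfies $\int\phi_k(t)\,dt=2$. Assume further that, for some constants $\alpha\ge0$ and $C\in\mathbb R$, $$\phi_k(1-t)=Ct^\alpha+o(t^\alpha)\qquad\text{as } t\downarrow0. \tag{1.15}$$ Let the bandwidths $g=g_n>0$ satisfy $g_n\to0$ and $g_n^{4+4\alpha}e^{\sigma^2/g_n^2}n^{-1}\to0$ as $n\to\infty$, and put $$p_{ng}=\frac g2\int_{-1/g}^{1/g}\frac{\phi_{emp}(t)\,\phi_k(gt)}{e^{-\sigma^2t^2/2}}\,dt,\qquad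 \phi_{emp}(t)=\frac1n\sum_{j=1}^n e^{itX_j}.$$ Then $p_{ng}$ is real-valued and integrable, and, as $n\to\infty$, $$\frac{\sqrt n}{g^{2+2\alpha}e^{\sigma^2/(2g^2)}}\,\bigl(p_{ng}-E[p_{ng}]\bigr)\ \xrightarrow{\ \mathcal D\ }\ N\!\left(0,\ \frac{C^2\,\Gamma(1+\alpha)^2}{2}\Bigl(\frac1{\sigma^2}\Bigr)^{2+2\alpha}\right).$$ -/

import Mathlib

open MeasureTheory ProbabilityTheory Filter Topology Asymptotics

namespace AtomicDeconvolution

/-- The Bernoulli law with probability of zero equal to `p`. -/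
noncomputable def bernoulliLaw (p : ℝ) : Measure ℝ :=
  ENNReal.ofReal p • Measure.dirac 0 + ENNReal.ofReal (1 - p) • Measure.dirac 1

/-- The characteristic function `φ_f(t) = ∫ e^{itx} f(x) dx` of the density `f`. -/
noncomputable def densityCharFun (f : ℝ → ℝ) (t : ℝ) : ℂ :=
  ∫ x : ℝ, Complex.exp (Complex.I * t * x) * f x

/-- The observation `X_i = U_i V_i + σ Z_i`. -/
def observation {Ω : Type*} (σ : ℝ) (U V Z : ℕ → Ω → ℝ) (i : ℕ) (ω : Ω) : ℝ :=
  U i ω * V i ω + σ * Z i ω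

/-- The deconvolution model for an atomic distribution: for every `i`, the variable `U i` is
Bernoulli with probability of zero `p`, `V i` has the density `f` and is independent of `U i`,
the noise `Z i` is standard normal and independent of `Y i = U i * V i`, and the observations
`X i = Y i + σ * Z i` are independent (they have the same law by the other fields). -/
structure IsModel {Ω : Type*} [MeasurableSpace Ω] (P : Measure Ω)
    (p σ : ℝ) (f : ℝ → ℝ) (U V Z : ℕ → Ω → ℝ) : Prop where
  p_nonneg : 0 ≤ p
  p_lt_one : p < 1
  sigma_pos : 0 < σ
  measurable_density : Measurable f
  density_nonneg : ∀ x, 0 ≤ f x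
  law_U : ∀ i, HasLaw (U i) (bernoulliLaw p) P
  law_V : ∀ i, HasLaw (V i) (volume.withDensity fun x => ENNReal.ofReal (f x)) P
  law_Z : ∀ i, HasLaw (Z i) (gaussianReal 0 1) P
  indep_UV : ∀ i, IndepFun (U i) (V i) P
  indep_YZ : ∀ i, IndepFun (fun ω => U i ω * V i ω) (Z i) P
  indep_X : iIndepFun (observation σ U V Z) P

/-- `φ` is the Fourier transform, with the convention `φ(t) = ∫ e^{itx} k(x) dx`, of the real
kernel `k`, in the sense of Plancherel: `k` is square integrable and the truncated integrals
over `[-R, R]` converge to `φ` in `L²` as `R → ∞`. Kernels whose transform jumps, such as the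
sinc kernel, are not absolutely integrable and need this sense; for integrable kernels whose
transform is square integrable it is the usual transform, up to null sets. -/
def IsFourierTransform (k : ℝ → ℝ) (φ : ℝ → ℂ) : Prop :=
  MemLp k 2 volume ∧
    Tendsto (fun R : ℝ => eLpNorm
        (fun t : ℝ => φ t - ∫ x in (-R)..R, Complex.exp (Complex.I * t * x) * k x) 2 volume)
      atTop (𝓝 0)

/-- The empirical characteristic function `φ_emp(t) = n⁻¹ ∑_j e^{itx_j}` of the first `n`
values of `x`. -/
noncomputable def empiricalCharFun (n : ℕ) (x : ℕ → ℝ) (t : ℝ) : ℂ :=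
  (1 / (n : ℂ)) * ∑ j ∈ Finset.range n, Complex.exp (Complex.I * t * x j)

/-- The estimator `p_{ng} = (g/2) ∫_{-1/g}^{1/g} φ_emp(t) φ_k(g t) / e^{-σ²t²/2} dt` of `p`,
computed from the first `n` values of `x`. It is written as a complex number; it is real when
`φ_k` is the Fourier transform of a real kernel. -/
noncomputable def pEstimator (σ : ℝ) (φ_k : ℝ → ℂ) (g : ℝ) (n : ℕ) (x : ℕ → ℝ) : ℂ :=
  ((g / 2 : ℝ) : ℂ) * ∫ t in (-(1 / g))..(1 / g),
    empiricalCharFun n x t * φ_k (g * t) / (Real.exp (-(σ ^ 2 * t ^ 2 / 2)) : ℂ)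

end AtomicDeconvolution

/-!
The estimator is an average `n⁻¹ ∑ j, W_g (X j)` of transformed observations, with
`W_g x = (g / 2) ∫ exp (i t x) φ_k (g t) exp (σ² t² / 2) dt` over `[-1/g, 1/g]`. Because of the
factor `exp (σ² t² / 2)` the integral is dominated by the endpoints `t = ± 1/g`. Hermitian symmetry
of `φ_k` folds the two endpoints into one real part, and the substitution `t = 1/g - g u` gives
`W_g x = g ^ (2 + 2α) exp (σ² / (2 g²)) * Re (exp (i x / g) * K_g x)`
(`AtomicDeconvolution.pEstimator_eq`), where `K_g` is the Laplace integral
`AtomicDeconvolution.kernelFactor`. By dominated convergence `K_g x` is bounded uniformly in `g` and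
`x`, and tends for each `x` to `A = C Γ(1 + α) / σ ^ (2 + 2α)`
(`AtomicDeconvolution.tendsto_kernelFactor`).

So the normalized summands are bounded and behave like `A cos (X / g)`. The Gaussian noise makes the
characteristic function of `X` vanish at infinity, hence `cos (X / g)` and `cos (2 X / g)` have mean
tending to `0`, and the variance of a summand tends to `A² / 2`
(`AtomicDeconvolution.tendsto_variance_re_exp_mul`). A central limit theorem for uniformly bounded
triangular arrays with i.i.d. rows
(`AtomicDeconvolution.tendstoInDistribution_inv_sqrt_mul_sum_of_bounded`) concludes. It follows from
Lévy's continuity theorem and a second-order expansion of characteristic functions.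
-/

namespace AtomicDeconvolution

/-! ### A central limit theorem for bounded triangular arrays -/

/-- Second-order expansion of the characteristic function of a centered bounded variable, with an
error that depends on the law only through the bound. This uniformity is what a triangular array
needs. -/
lemma norm_charFun_sub_le_of_bounded {Ω : Type*} [MeasurableSpace Ω] {P : Measure Ω}
    [IsProbabilityMeasure P] {Y : Ω → ℝ} (hY : AEMeasurable Y P) {B : ℝ} (hB : ∀ ω, |Y ω| ≤ B)
    (h0 : ∫ ω, Y ω ∂P = 0) {s : ℝ} (hs : |s| * B ≤ 1) :
    ‖charFun (P.map Y) s - (1 - (s ^ 2 * (∫ ω, Y ω ^ 2 ∂P) / 2 : ℝ))‖ ≤ (|s| * B) ^ 3 := by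
  have hYi : Integrable Y P :=
    Integrable.of_bound hY.aestronglyMeasurable B (.of_forall hB)
  have hY2 : Integrable (fun ω => Y ω ^ 2) P := by
    refine Integrable.of_bound (hY.pow_const 2).aestronglyMeasurable (B ^ 2)
      (.of_forall fun ω => ?_)
    rw [Real.norm_eq_abs, abs_pow]
    exact pow_le_pow_left₀ (abs_nonneg _) (hB ω) 2
  have hexp : Integrable (fun ω => Complex.exp ((s * Y ω : ℝ) * Complex.I)) P := by
    refine Integrable.of_bound (C := 1) ?_ (.of_forall fun ω => ?_)
    · exact (Complex.measurable_exp.comp_aemeasurable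
        ((Complex.measurable_ofReal.comp_aemeasurable
          (hY.const_mul s)).mul_const _)).aestronglyMeasurable
    · exact (Complex.norm_exp_ofReal_mul_I _).le
  have hpol : Integrable
      (fun ω => (1 : ℂ) + (s * Y ω : ℝ) * Complex.I - (s ^ 2 * Y ω ^ 2 / 2 : ℝ)) P :=
    ((integrable_const _).add ((hYi.const_mul s).ofReal.mul_const _)).sub
      ((hY2.const_mul (s ^ 2)).div_const 2).ofReal
  have hval : ∫ ω, ((1 : ℂ) + (s * Y ω : ℝ) * Complex.I - (s ^ 2 * Y ω ^ 2 / 2 : ℝ)) ∂P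
      = 1 - (s ^ 2 * (∫ ω, Y ω ^ 2 ∂P) / 2 : ℝ) := by
    rw [integral_sub ((integrable_const _).add ((hYi.const_mul s).ofReal.mul_const _))
      ((hY2.const_mul (s ^ 2)).div_const 2).ofReal,
      integral_add (integrable_const _) ((hYi.const_mul s).ofReal.mul_const _),
      integral_mul_const, integral_complex_ofReal, integral_complex_ofReal, integral_const_mul, h0,
      integral_div, integral_const_mul]
    simp
  have hcf : charFun (P.map Y) s = ∫ ω, Complex.exp ((s * Y ω : ℝ) * Complex.I) ∂P := by
    rw [charFun_apply_real, integral_map hY (by fun_prop)]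
    simp
  rw [hcf, ← hval, ← integral_sub hexp hpol]
  refine (norm_integral_le_of_norm_le_const (C := (|s| * B) ^ 3) (.of_forall fun ω => ?_)).trans
    (by simp)
  have hn : ‖((s * Y ω : ℝ) : ℂ) * Complex.I‖ = |s| * |Y ω| := by simp
  have hle : |s| * |Y ω| ≤ |s| * B := mul_le_mul_of_nonneg_left (hB ω) (abs_nonneg _)
  have := Complex.exp_bound (x := ((s * Y ω : ℝ) : ℂ) * Complex.I) (hn ▸ hle.trans hs)
    (n := 3) (by norm_num)
  rw [hn] at this
  have hsum : ∑ m ∈ Finset.range 3, (((s * Y ω : ℝ) : ℂ) * Complex.I) ^ m / (m.factorial : ℂ)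
      = (1 : ℂ) + (s * Y ω : ℝ) * Complex.I - (s ^ 2 * Y ω ^ 2 / 2 : ℝ) := by
    simp only [Finset.sum_range_succ, Finset.sum_range_zero, Nat.factorial, mul_pow, Complex.I_sq]
    push_cast
    ring
  rw [hsum] at this
  refine this.trans ?_
  have h3 : (|s| * |Y ω|) ^ 3 ≤ (|s| * B) ^ 3 := pow_le_pow_left₀ (by positivity) hle 3
  refine le_trans ?_ h3
  refine mul_le_of_le_one_right (by positivity) ?_
  norm_num [Nat.factorial]

/-- **Central limit theorem for bounded triangular arrays with i.i.d. rows**: the `n`-th row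
consists of the transforms `T n (X j)`, `j < n`, of a fixed i.i.d. sequence, uniformly bounded and
with variances tending to `v`. The case `v = 0` of a degenerate limit is included. -/
theorem tendstoInDistribution_inv_sqrt_mul_sum_of_bounded {Ω : Type*} [MeasurableSpace Ω]
    {P : Measure Ω} [IsProbabilityMeasure P] {X : ℕ → Ω → ℝ} (hindep : iIndepFun X P)
    (hident : ∀ i, IdentDistrib (X i) (X 0) P P) {T : ℕ → ℝ → ℝ} (hT : ∀ n, Measurable (T n))
    {B : ℝ} (hB : ∀ n x, |T n x| ≤ B) {v : ℝ}
    (hv : Tendsto (fun n => Var[fun ω => T n (X 0 ω); P]) atTop (𝓝 v)) :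
    TendstoInDistribution
      (fun (n : ℕ) ω => (√n)⁻¹ * ∑ j ∈ Finset.range n,
        (T n (X j ω) - ∫ ω', T n (X 0 ω') ∂P)) atTop (id : ℝ → ℝ) (fun _ => P)
      (gaussianReal 0 v.toNNReal) := by
  have hv0 : 0 ≤ v := ge_of_tendsto' hv fun n => variance_nonneg _ _
  have hXm : ∀ i, AEMeasurable (X i) P := fun i => (hident i).aemeasurable_fst
  set m : ℕ → ℝ := fun n => ∫ ω', T n (X 0 ω') ∂P with hm
  have hTm : ∀ n, Measurable fun x => T n x - m n := fun n => (hT n).sub_const _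
  have hYm : ∀ n j, AEMeasurable (fun ω => T n (X j ω) - m n) P :=
    fun n j => (hTm n).comp_aemeasurable (hXm j)
  have hmB : ∀ n, |m n| ≤ B := fun n => by
    have := norm_integral_le_of_norm_le_const (μ := P) (f := fun ω => T n (X 0 ω)) (C := B)
      (.of_forall fun ω => hB n _)
    simpa using this
  have hYB : ∀ n ω, |T n (X 0 ω) - m n| ≤ 2 * B := fun n ω => by
    have := abs_sub (T n (X 0 ω)) (m n)
    linarith [hB n (X 0 ω), hmB n]
  have hTi : ∀ n, Integrable (fun ω => T n (X 0 ω)) P := fun n =>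
    Integrable.of_bound ((hT n).comp_aemeasurable (hXm 0)).aestronglyMeasurable B
      (.of_forall fun ω => hB n _)
  have hY0 : ∀ n, ∫ ω, (T n (X 0 ω) - m n) ∂P = 0 := fun n => by
    rw [integral_sub (hTi n) (integrable_const _)]; simp [hm]
  refine ⟨fun n => .const_mul (Finset.aemeasurable_fun_sum _ fun j _ => hYm n j) _,
    aemeasurable_id, ?_⟩
  refine ProbabilityMeasure.tendsto_iff_tendsto_charFun.2 fun t => ?_
  change Tendsto (fun n : ℕ => charFun (P.map fun ω => (√n)⁻¹ * ∑ j ∈ Finset.range n,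
      (T n (X j ω) - m n)) t) atTop (𝓝 (charFun ((gaussianReal 0 v.toNNReal).map id) t))
  rw [Measure.map_id]
  have hcf : ∀ n : ℕ, charFun (P.map fun ω => (√n)⁻¹ * ∑ j ∈ Finset.range n,
      (T n (X j ω) - m n)) t
        = (1 + (charFun (P.map fun ω => T n (X 0 ω) - m n) ((√n)⁻¹ * t) - 1)) ^ n := fun n => by
    rw [charFun_map_mul_comp (Finset.aemeasurable_fun_sum _ fun j _ => hYm n j),
      iIndepFun.charFun_map_fun_finsetSum_eq_prod (fun j _ => hYm n j)
        ((hindep.comp (fun _ x => T n x - m n) fun _ => hTm n).restrict _)]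
    have : ∀ j, P.map (fun ω => T n (X j ω) - m n) = P.map (fun ω => T n (X 0 ω) - m n) :=
      fun j => ((hident j).comp (hTm n)).map_eq
    simp [this]
  rw [charFun_gaussianReal]
  simp_rw [hcf]
  have hvar : ∀ n, ∫ ω, (T n (X 0 ω) - m n) ^ 2 ∂P = Var[fun ω => T n (X 0 ω); P] := fun n =>
    (variance_eq_integral ((hT n).comp_aemeasurable (hXm 0))).symm
  have hlim : Tendsto (fun n : ℕ => (n : ℂ) *
      (charFun (P.map fun ω => T n (X 0 ω) - m n) ((√n)⁻¹ * t) - 1)) atTop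
      (𝓝 (-(v * t ^ 2 / 2 : ℝ))) := by
    have hs0 : Tendsto (fun n : ℕ => |(√n)⁻¹ * t| * (2 * B)) atTop (𝓝 0) := by
      have : Tendsto (fun n : ℕ => (√(n : ℝ))⁻¹ * t) atTop (𝓝 0) := by
        rw [← zero_mul t]
        exact .mul_const t (tendsto_inv_atTop_zero.comp <| Real.tendsto_sqrt_atTop.comp <|
          tendsto_natCast_atTop_atTop)
      simpa using (this.abs.mul_const (2 * B))
    have hmain : Tendsto (fun n : ℕ => -((Var[fun ω => T n (X 0 ω); P] * t ^ 2 / 2 : ℝ) : ℂ)) atTop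
        (𝓝 (-(v * t ^ 2 / 2 : ℝ))) :=
      ((Complex.continuous_ofReal.tendsto _).comp ((hv.mul_const _).div_const _)).neg
    have herr : Tendsto (fun n : ℕ => (|t| * (2 * B)) ^ 2 * (|(√n)⁻¹ * t| * (2 * B))) atTop
        (𝓝 0) := by simpa using hs0.const_mul ((|t| * (2 * B)) ^ 2)
    have hdiff : Tendsto (fun n : ℕ => (n : ℂ) *
        (charFun (P.map fun ω => T n (X 0 ω) - m n) ((√n)⁻¹ * t) - 1)
          - -((Var[fun ω => T n (X 0 ω); P] * t ^ 2 / 2 : ℝ) : ℂ)) atTop (𝓝 0) := by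
      refine squeeze_zero_norm' ?_ herr
      filter_upwards [hs0.eventually (gt_mem_nhds one_pos), eventually_gt_atTop 0] with n hn hn0
      have hb := norm_charFun_sub_le_of_bounded (hYm n 0) (hYB n) (hY0 n) hn.le
      rw [hvar] at hb
      have hnpos : (0 : ℝ) < n := by exact_mod_cast hn0
      have hsq : (√(n : ℝ)) ^ 2 = n := Real.sq_sqrt hnpos.le
      have hn1 : (n : ℝ) * ((√n)⁻¹ * t) ^ 2 = t ^ 2 := by
        rw [mul_pow, inv_pow, hsq]; field_simp
      have heq : (n : ℂ) * (charFun (P.map fun ω => T n (X 0 ω) - m n) ((√n)⁻¹ * t) - 1)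
          - -((Var[fun ω => T n (X 0 ω); P] * t ^ 2 / 2 : ℝ) : ℂ)
          = (n : ℂ) * (charFun (P.map fun ω => T n (X 0 ω) - m n) ((√n)⁻¹ * t)
            - (1 - ((((√n)⁻¹ * t) ^ 2 * Var[fun ω => T n (X 0 ω); P] / 2 : ℝ) : ℂ))) := by
        rw [← hn1]
        push_cast
        ring
      rw [heq, norm_mul, Complex.norm_natCast]
      refine (mul_le_mul_of_nonneg_left hb hnpos.le).trans (le_of_eq ?_)
      have : (|t| * (2 * B)) ^ 2 = n * (|(√n)⁻¹ * t| * (2 * B)) ^ 2 := by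
        simp only [mul_pow, sq_abs] at hn1 ⊢
        linear_combination (-(4 * B ^ 2)) * hn1
      rw [this]; ring
    simpa using hdiff.add hmain
  convert Complex.tendsto_one_add_pow_exp_of_tendsto hlim using 2
  · simp [Real.coe_toNNReal _ hv0]

/-! ### The transform of the kernel -/

/-- The Fourier transform of a real kernel is Hermitian. Truncated transforms have this symmetry
exactly, and it survives the `L²` limit almost everywhere. -/
lemma IsFourierTransform.ae_neg_eq_conj {k : ℝ → ℝ} {φ : ℝ → ℂ} (hk : IsFourierTransform k φ)
    (hφ : AEStronglyMeasurable φ volume) : ∀ᵐ t, φ (-t) = (starRingEnd ℂ) (φ t) := by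
  obtain ⟨hk2, hlim⟩ := hk
  set F : ℝ → ℝ → ℂ := fun R t => ∫ x in (-R)..R, Complex.exp (Complex.I * t * x) * k x with hF
  have hkint : ∀ a b, IntervalIntegrable k volume a b := fun a b => by
    exact ((hk2.locallyIntegrable (by norm_num)).integrableOn_isCompact
      isCompact_uIcc).intervalIntegrable
  have hFc : ∀ R, Continuous (F R) := fun R => by
    refine intervalIntegral.continuous_of_dominated_interval (bound := fun x => ‖k x‖)
      (fun t => ?_) (fun t => .of_forall fun x _ => ?_) (hkint _ _).norm
      (.of_forall fun x _ => by fun_prop)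
    · refine AEStronglyMeasurable.mul (by fun_prop) ?_
      exact Complex.continuous_ofReal.comp_aestronglyMeasurable hk2.1.restrict
    · have : ‖Complex.exp (Complex.I * t * x)‖ = 1 := by
        rw [show Complex.I * t * x = ((t * x : ℝ) : ℂ) * Complex.I by push_cast; ring]
        exact Complex.norm_exp_ofReal_mul_I _
      simp [this]
  have hFsymm : ∀ R t, F R (-t) = (starRingEnd ℂ) (F R t) := fun R t => by
    simp only [hF, intervalIntegral, map_sub, ← integral_conj]
    congr 2 <;>
    · ext x
      rw [map_mul, ← Complex.exp_conj]
      simp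
  have hψ : AEStronglyMeasurable (fun t => (starRingEnd ℂ) (φ (-t))) volume :=
    Complex.continuous_conj.comp_aestronglyMeasurable
      (hφ.comp_measurePreserving (Measure.measurePreserving_neg volume))
  have heq : ∀ R, eLpNorm (fun t => (starRingEnd ℂ) (φ (-t)) - F R t) 2 volume
      = eLpNorm (fun t => φ t - F R t) 2 volume := fun R => by
    change _ = eLpNorm (φ - F R) 2 volume
    rw [← eLpNorm_comp_measurePreserving (hφ.sub (hFc R).aestronglyMeasurable)
      (Measure.measurePreserving_neg (volume : Measure ℝ))]
    refine eLpNorm_congr_norm_ae (.of_forall fun t => ?_)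
    simp only [Function.comp_apply, hFsymm, Pi.sub_apply]
    rw [← RCLike.norm_conj (φ (-t) - _), map_sub, Complex.conj_conj]
  have hle : ∀ R, eLpNorm (φ - fun t => (starRingEnd ℂ) (φ (-t))) 2 volume
      ≤ eLpNorm (fun t => φ t - F R t) 2 volume + eLpNorm (fun t => φ t - F R t) 2 volume :=
    fun R => by
      have h := eLpNorm_sub_le (hφ.sub (hFc R).aestronglyMeasurable)
        (hψ.sub (hFc R).aestronglyMeasurable) (p := 2) (by norm_num)
      rw [show eLpNorm ((fun t => (starRingEnd ℂ) (φ (-t))) - F R) 2 volume = _ from heq R,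
        sub_sub_sub_cancel_right] at h
      exact h
  have hz : eLpNorm (φ - fun t => (starRingEnd ℂ) (φ (-t))) 2 volume = 0 := by
    have := ge_of_tendsto' (hlim.add hlim) hle
    simpa using this
  rw [eLpNorm_eq_zero_iff (hφ.sub hψ) (by norm_num)] at hz
  filter_upwards [hz] with t ht
  have : φ t = (starRingEnd ℂ) (φ (-t)) := sub_eq_zero.1 ht
  rw [this, Complex.conj_conj]

/-- The expansion of `φ` at the right end of its support, together with boundedness, bounds
`φ (1 - t)` by a multiple of `t ^ α` for every `t > 0`, not only for small `t`. -/
lemma exists_norm_one_sub_le_mul_rpow {φ : ℝ → ℂ} {M : ℝ} (hM : ∀ t, ‖φ t‖ ≤ M) {α C : ℝ}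
    (hα : 0 ≤ α)
    (hC : (fun t : ℝ => φ (1 - t) - ((C * t ^ α : ℝ) : ℂ)) =o[𝓝[>] 0] fun t : ℝ => t ^ α) :
    ∃ D : ℝ, ∀ t, 0 < t → ‖φ (1 - t)‖ ≤ D * t ^ α := by
  have h1 := hC.bound one_pos
  obtain ⟨δ, hδ, h⟩ := mem_nhdsGT_iff_exists_Ioo_subset.1 h1
  have hδ0 : (0 : ℝ) < δ := hδ
  have hM0 : 0 ≤ M := (norm_nonneg _).trans (hM 0)
  refine ⟨max (1 + |C|) (M * (δ ^ α)⁻¹), fun t ht => ?_⟩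
  have htα : 0 < t ^ α := Real.rpow_pos_of_pos ht α
  rcases lt_or_ge t δ with htδ | htδ
  · have h2 : ‖φ (1 - t) - ((C * t ^ α : ℝ) : ℂ)‖ ≤ 1 * ‖t ^ α‖ := h ⟨ht, htδ⟩
    have h3 : ‖φ (1 - t)‖ ≤ ‖φ (1 - t) - ((C * t ^ α : ℝ) : ℂ)‖ + ‖((C * t ^ α : ℝ) : ℂ)‖ := by
      simpa using norm_add_le (φ (1 - t) - ((C * t ^ α : ℝ) : ℂ)) ((C * t ^ α : ℝ) : ℂ)
    rw [Complex.norm_real, Real.norm_eq_abs, abs_mul, abs_of_pos htα] at h3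
    rw [Real.norm_eq_abs, abs_of_pos htα] at h2
    calc ‖φ (1 - t)‖ ≤ (1 + |C|) * t ^ α := by linarith
      _ ≤ _ := mul_le_mul_of_nonneg_right (le_max_left _ _) htα.le
  · have hδα : 0 < δ ^ α := Real.rpow_pos_of_pos hδ0 α
    calc ‖φ (1 - t)‖ ≤ M := hM _
      _ = M * (δ ^ α)⁻¹ * δ ^ α := by field_simp
      _ ≤ M * (δ ^ α)⁻¹ * t ^ α :=
          mul_le_mul_of_nonneg_left (Real.rpow_le_rpow hδ0.le htδ hα) (by positivity)
      _ ≤ _ := mul_le_mul_of_nonneg_right (le_max_right _ _) htα.le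

/-! ### The rescaled deconvolution kernel -/

/-- The integrand of `kernelFactor`, extended by zero outside `(0, 1 / g ^ 2]` so that all `g` share
the same domain of integration. -/
noncomputable def kernelIntegrand (σ α : ℝ) (φ : ℝ → ℂ) (g x u : ℝ) : ℂ :=
  (Set.Ioc 0 (1 / g ^ 2)).indicator (fun u : ℝ =>
    Complex.exp ((-(g * u * x) : ℝ) * Complex.I) * (φ (1 - g ^ 2 * u) / ((g ^ (2 * α) : ℝ) : ℂ)) *
      (Real.exp (-(σ ^ 2 * u) + σ ^ 2 * g ^ 2 * u ^ 2 / 2) : ℂ)) u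

/-- The deconvolution kernel at `x` after removal of the deterministic factor
`g ^ (2 + 2 * α) * exp (σ ^ 2 / (2 * g ^ 2))` and of the oscillation `exp (i x / g)`: the Laplace
integral obtained by zooming in on the endpoint `t = 1 / g` at scale `t = 1 / g - g * u`. -/
noncomputable def kernelFactor (σ α : ℝ) (φ : ℝ → ℂ) (g x : ℝ) : ℂ :=
  ∫ u, kernelIntegrand σ α φ g x u

section KernelFactor

variable {σ α : ℝ} {φ : ℝ → ℂ}

/-- The integrable majorant comes from `g ^ 2 * u ≤ 1`, which makes the quadratic term of the
exponent at most half of the linear one. -/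
lemma norm_kernelIntegrand_le {D : ℝ} (hD : ∀ t, 0 < t → ‖φ (1 - t)‖ ≤ D * t ^ α) {g : ℝ}
    (hg : 0 < g) (x u : ℝ) :
    ‖kernelIntegrand σ α φ g x u‖ ≤
      (Set.Ioi 0).indicator (fun u => D * (u ^ α * Real.exp (-(σ ^ 2 / 2) * u))) u := by
  have hD0 : 0 ≤ D := by simpa using (norm_nonneg _).trans (hD 1 one_pos)
  unfold kernelIntegrand
  by_cases hu : u ∈ Set.Ioc 0 (1 / g ^ 2)
  · have hu0 : 0 < u := hu.1
    have hgu : g ^ 2 * u ≤ 1 := by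
      have := hu.2
      rwa [le_div_iff₀ (by positivity), mul_comm] at this
    rw [Set.indicator_of_mem hu, Set.indicator_of_mem (Set.mem_Ioi.2 hu0), norm_mul, norm_mul,
      Complex.norm_exp_ofReal_mul_I, one_mul, norm_div, Complex.norm_real, Complex.norm_real,
      Real.norm_of_nonneg (Real.rpow_nonneg hg.le _), Real.norm_of_nonneg (Real.exp_pos _).le,
      ← mul_assoc]
    have h1 : ‖φ (1 - g ^ 2 * u)‖ / g ^ (2 * α) ≤ D * u ^ α := by
      rw [div_le_iff₀ (Real.rpow_pos_of_pos hg _)]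
      refine (hD _ (by positivity)).trans (le_of_eq ?_)
      rw [Real.mul_rpow (by positivity) hu0.le, ← Real.rpow_natCast, ← Real.rpow_mul hg.le]
      push_cast
      ring
    refine mul_le_mul h1 (Real.exp_le_exp.2 ?_) (Real.exp_pos _).le (by positivity)
    nlinarith [mul_nonneg (mul_nonneg (sq_nonneg σ) hu0.le) (sub_nonneg.2 hgu)]
  · rw [Set.indicator_of_notMem hu, norm_zero]
    exact Set.indicator_nonneg (fun v hv => by
      have := Real.rpow_nonneg (le_of_lt hv) α
      positivity) _

lemma integrable_kernel_majorant (hσ : 0 < σ) (hα : 0 ≤ α) (D : ℝ) :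
    Integrable ((Set.Ioi 0).indicator fun u : ℝ => D * (u ^ α * Real.exp (-(σ ^ 2 / 2) * u))) := by
  rw [integrable_indicator_iff measurableSet_Ioi]
  have := integrableOn_rpow_mul_exp_neg_mul_rpow (p := 1) (s := α) (b := σ ^ 2 / 2) (by linarith)
    one_pos (by positivity)
  simp only [Real.rpow_one] at this
  exact this.const_mul D

lemma aestronglyMeasurable_kernelIntegrand (hφ : Integrable φ) {g : ℝ} (hg : 0 < g) (x : ℝ) :
    AEStronglyMeasurable (kernelIntegrand σ α φ g x) := by
  have h1 : Integrable fun u => φ (1 - g ^ 2 * u) :=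
    (hφ.comp_sub_left 1).comp_mul_left' (by positivity)
  refine AEStronglyMeasurable.indicator ?_ measurableSet_Ioc
  refine (AEStronglyMeasurable.mul (by fun_prop) ?_).mul (by fun_prop)
  exact (h1.div_const _).aestronglyMeasurable

lemma norm_kernelFactor_le (hσ : 0 < σ) (hα : 0 ≤ α) {D : ℝ}
    (hD : ∀ t, 0 < t → ‖φ (1 - t)‖ ≤ D * t ^ α) {g : ℝ} (hg : 0 < g) (x : ℝ) :
    ‖kernelFactor σ α φ g x‖ ≤
      ∫ u, (Set.Ioi 0).indicator (fun u => D * (u ^ α * Real.exp (-(σ ^ 2 / 2) * u))) u :=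
  norm_integral_le_of_norm_le (integrable_kernel_majorant hσ hα D)
    (.of_forall fun u => norm_kernelIntegrand_le hD hg x u)

lemma continuous_kernelFactor (hσ : 0 < σ) (hα : 0 ≤ α) (hφ : Integrable φ) {D : ℝ}
    (hD : ∀ t, 0 < t → ‖φ (1 - t)‖ ≤ D * t ^ α) {g : ℝ} (hg : 0 < g) :
    Continuous (kernelFactor σ α φ g) := by
  refine continuous_of_dominated (fun x => aestronglyMeasurable_kernelIntegrand hφ hg x)
    (fun x => .of_forall fun u => norm_kernelIntegrand_le hD hg x u)
    (integrable_kernel_majorant hσ hα D) (.of_forall fun u => ?_)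
  unfold kernelIntegrand
  by_cases hu : u ∈ Set.Ioc 0 (1 / g ^ 2)
  · simp only [Set.indicator_of_mem hu]
    fun_prop
  · simp only [Set.indicator_of_notMem hu]
    fun_prop

/-- The Laplace integral converges to its limit `C * ∫ u ^ α * exp (-σ ^ 2 * u)`, a Gamma
integral. -/
lemma tendsto_kernelFactor (hσ : 0 < σ) (hα : 0 ≤ α) (hφ : Integrable φ) {D C : ℝ}
    (hD : ∀ t, 0 < t → ‖φ (1 - t)‖ ≤ D * t ^ α)
    (hC : (fun t : ℝ => φ (1 - t) - ((C * t ^ α : ℝ) : ℂ)) =o[𝓝[>] 0] fun t : ℝ => t ^ α)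
    {g : ℕ → ℝ} (hgpos : ∀ n, 0 < g n) (hg : Tendsto g atTop (𝓝 0)) (x : ℝ) :
    Tendsto (fun n => kernelFactor σ α φ (g n) x) atTop
      (𝓝 ((C * ((1 / σ ^ 2) ^ (1 + α) * Real.Gamma (1 + α)) : ℝ) : ℂ)) := by
  have hlimval : ((C * ((1 / σ ^ 2) ^ (1 + α) * Real.Gamma (1 + α)) : ℝ) : ℂ)
      = ∫ u, (Set.Ioi 0).indicator
        (fun u : ℝ => ((C * (u ^ α * Real.exp (-(σ ^ 2 * u))) : ℝ) : ℂ)) u := by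
    rw [integral_indicator measurableSet_Ioi, integral_complex_ofReal, integral_const_mul]
    have := Real.integral_rpow_mul_exp_neg_mul_Ioi (a := 1 + α) (r := σ ^ 2) (by linarith)
      (by positivity)
    rw [add_sub_cancel_left] at this
    rw [this]
  rw [hlimval]
  refine tendsto_integral_of_dominated_convergence _
    (fun n => aestronglyMeasurable_kernelIntegrand hφ (hgpos n) x)
    (integrable_kernel_majorant hσ hα D)
    (fun n => .of_forall fun u => norm_kernelIntegrand_le hD (hgpos n) x u)
    (.of_forall fun u => ?_)
  unfold kernelIntegrand
  rcases le_or_gt u 0 with hu | hu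
  · have h1 : ∀ a : ℝ, u ∉ Set.Ioc 0 a := fun a h => absurd h.1 (not_lt.2 hu)
    have h2 : u ∉ Set.Ioi (0 : ℝ) := fun h => absurd h (not_lt.2 hu)
    simp only [Set.indicator_of_notMem (h1 _), Set.indicator_of_notMem h2]
    exact tendsto_const_nhds
  rw [Set.indicator_of_mem (Set.mem_Ioi.2 hu)]
  have hg2u : Tendsto (fun n => g n ^ 2 * u) atTop (𝓝 0) := by
    simpa using (hg.pow 2).mul_const u
  have hmem : ∀ᶠ n in atTop, u ∈ Set.Ioc 0 (1 / g n ^ 2) := by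
    filter_upwards [hg2u.eventually (gt_mem_nhds one_pos)] with n hn
    refine ⟨hu, ?_⟩
    rw [le_div_iff₀ (pow_pos (hgpos n) 2), mul_comm]
    exact hn.le
  have hcong : ∀ᶠ n in atTop, Complex.exp ((-(g n * u * x) : ℝ) * Complex.I) *
      (φ (1 - g n ^ 2 * u) / ((g n ^ (2 * α) : ℝ) : ℂ)) *
      (Real.exp (-(σ ^ 2 * u) + σ ^ 2 * g n ^ 2 * u ^ 2 / 2) : ℂ) =
      (Set.Ioc 0 (1 / g n ^ 2)).indicator (fun u : ℝ =>
        Complex.exp ((-(g n * u * x) : ℝ) * Complex.I) *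
        (φ (1 - g n ^ 2 * u) / ((g n ^ (2 * α) : ℝ) : ℂ)) *
        (Real.exp (-(σ ^ 2 * u) + σ ^ 2 * g n ^ 2 * u ^ 2 / 2) : ℂ)) u := by
    filter_upwards [hmem] with n hn
    rw [Set.indicator_of_mem hn]
  refine Tendsto.congr' hcong ?_
  have hE : Tendsto (fun n => Complex.exp ((-(g n * u * x) : ℝ) * Complex.I)) atTop (𝓝 1) := by
    have : Continuous fun s : ℝ => Complex.exp ((-(s * u * x) : ℝ) * Complex.I) := by fun_prop
    simpa [Function.comp_def] using (this.tendsto 0).comp hg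
  have hR : Tendsto (fun n => (Real.exp (-(σ ^ 2 * u) + σ ^ 2 * g n ^ 2 * u ^ 2 / 2) : ℂ)) atTop
      (𝓝 (Real.exp (-(σ ^ 2 * u)) : ℂ)) := by
    have : Continuous fun s : ℝ =>
        (Real.exp (-(σ ^ 2 * u) + σ ^ 2 * s ^ 2 * u ^ 2 / 2) : ℂ) := by fun_prop
    simpa [Function.comp_def] using (this.tendsto 0).comp hg
  have hφlim : Tendsto (fun n => φ (1 - g n ^ 2 * u) / ((g n ^ (2 * α) : ℝ) : ℂ)) atTop
      (𝓝 ((C * u ^ α : ℝ) : ℂ)) := by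
    have hg2u' : Tendsto (fun n => g n ^ 2 * u) atTop (𝓝[>] 0) :=
      tendsto_nhdsWithin_iff.2 ⟨hg2u, .of_forall fun n => mul_pos (pow_pos (hgpos n) 2) hu⟩
    have h1 := (hC.comp_tendsto hg2u').tendsto_inv_smul_nhds_zero
    have h2 := (h1.const_mul ((u ^ α : ℝ) : ℂ)).add_const ((C * u ^ α : ℝ) : ℂ)
    simp only [mul_zero, zero_add] at h2
    refine h2.congr fun n => ?_
    have hgα : g n ^ (2 * α) ≠ 0 := (Real.rpow_pos_of_pos (hgpos n) _).ne'
    have huα : u ^ α ≠ 0 := (Real.rpow_pos_of_pos hu _).ne'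
    have hsplit : (g n ^ 2 * u) ^ α = g n ^ (2 * α) * u ^ α := by
      rw [Real.mul_rpow (by positivity) hu.le, ← Real.rpow_natCast,
        ← Real.rpow_mul (hgpos n).le]
      push_cast
      ring_nf
    have hgα' : ((g n ^ (2 * α) : ℝ) : ℂ) ≠ 0 := by exact_mod_cast hgα
    have huα' : ((u ^ α : ℝ) : ℂ) ≠ 0 := by exact_mod_cast huα
    simp only [Function.comp_apply, hsplit, Complex.real_smul]
    push_cast at hgα' huα' ⊢
    field_simp
    ring
  have := (hE.mul hφlim).mul hR
  convert this using 2
  push_cast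
  ring

end KernelFactor

/-! ### The law of the observations and the asymptotic variance -/

section Model

variable {Ω : Type*} [MeasurableSpace Ω] {P : Measure Ω} {p σ : ℝ}
  {f : ℝ → ℝ} {U V Z : ℕ → Ω → ℝ}

lemma IsModel.aemeasurable_observation (h : IsModel P p σ f U V Z) (i : ℕ) :
    AEMeasurable (observation σ U V Z i) P :=
  ((h.law_U i).aemeasurable.mul (h.law_V i).aemeasurable).add
    ((h.law_Z i).aemeasurable.const_mul σ)

variable [IsProbabilityMeasure P]

lemma IsModel.identDistrib_observation (h : IsModel P p σ f U V Z) (i : ℕ) :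
    IdentDistrib (observation σ U V Z i) (observation σ U V Z 0) P P := by
  have hU : IdentDistrib (U i) (U 0) P P :=
    ⟨(h.law_U i).aemeasurable, (h.law_U 0).aemeasurable,
      (h.law_U i).map_eq.trans (h.law_U 0).map_eq.symm⟩
  have hV : IdentDistrib (V i) (V 0) P P :=
    ⟨(h.law_V i).aemeasurable, (h.law_V 0).aemeasurable,
      (h.law_V i).map_eq.trans (h.law_V 0).map_eq.symm⟩
  have hZ : IdentDistrib (Z i) (Z 0) P P :=
    ⟨(h.law_Z i).aemeasurable, (h.law_Z 0).aemeasurable,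
      (h.law_Z i).map_eq.trans (h.law_Z 0).map_eq.symm⟩
  have hY : IdentDistrib (fun ω => U i ω * V i ω) (fun ω => U 0 ω * V 0 ω) P P :=
    (hU.prodMk hV (h.indep_UV i) (h.indep_UV 0)).comp (u := fun q : ℝ × ℝ => q.1 * q.2)
      (by fun_prop)
  exact (hY.prodMk hZ (h.indep_YZ i) (h.indep_YZ 0)).comp
    (u := fun q : ℝ × ℝ => q.1 + σ * q.2) (by fun_prop)

lemma IsModel.norm_charFun_observation_le (h : IsModel P p σ f U V Z) (t : ℝ) :
    ‖charFun (P.map (observation σ U V Z 0)) t‖ ≤ Real.exp (-(σ ^ 2 * t ^ 2 / 2)) := by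
  have hYm : AEMeasurable (fun ω => U 0 ω * V 0 ω) P :=
    (h.law_U 0).aemeasurable.mul (h.law_V 0).aemeasurable
  have hZm := (h.law_Z 0).aemeasurable
  have hind : IndepFun (fun ω => U 0 ω * V 0 ω) (fun ω => σ * Z 0 ω) P :=
    (h.indep_YZ 0).comp (φ := id) (ψ := fun z => σ * z) measurable_id (by fun_prop)
  have hcf : charFun (P.map (observation σ U V Z 0))
      = charFun (P.map fun ω => U 0 ω * V 0 ω) * charFun (P.map fun ω => σ * Z 0 ω) :=
    hind.charFun_map_fun_add_eq_mul hYm (hZm.const_mul σ)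
  have : IsProbabilityMeasure (P.map fun ω => U 0 ω * V 0 ω) :=
    Measure.isProbabilityMeasure_map hYm
  rw [hcf, Pi.mul_apply, norm_mul, charFun_map_mul_comp hZm, (h.law_Z 0).map_eq,
    charFun_gaussianReal]
  refine (mul_le_of_le_one_left (norm_nonneg _) (norm_charFun_le_one _)).trans (le_of_eq ?_)
  rw [Complex.norm_exp]
  congr 1
  simp [← Complex.ofReal_pow, mul_pow]

/-- The Gaussian noise makes the characteristic function of an observation vanish at infinity. -/
lemma IsModel.tendsto_charFun_observation (h : IsModel P p σ f U V Z) :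
    Tendsto (charFun (P.map (observation σ U V Z 0))) atTop (𝓝 0) := by
  refine squeeze_zero_norm h.norm_charFun_observation_le ?_
  refine Real.tendsto_exp_neg_atTop_nhds_zero.comp ?_
  have := h.sigma_pos
  have h2 : Tendsto (fun t : ℝ => σ ^ 2 / 2 * t ^ 2) atTop atTop :=
    (tendsto_pow_atTop two_ne_zero).const_mul_atTop (by positivity)
  exact h2.congr fun t => by ring

end Model

lemma integral_cos_eq_re_charFun {Ω : Type*} [MeasurableSpace Ω] {P : Measure Ω}
    [IsProbabilityMeasure P] {X : Ω → ℝ} (hX : AEMeasurable X P) (t : ℝ) :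
    ∫ ω, Real.cos (t * X ω) ∂P = (charFun (P.map X) t).re := by
  have hi : Integrable (fun x : ℝ => Complex.exp (t * x * Complex.I)) (P.map X) := by
    have : IsProbabilityMeasure (P.map X) := Measure.isProbabilityMeasure_map hX
    refine Integrable.of_bound (C := 1) (by fun_prop) (.of_forall fun x => ?_)
    rw [← Complex.ofReal_mul]
    exact (Complex.norm_exp_ofReal_mul_I _).le
  rw [charFun_apply_real, ← Complex.reCLM_apply, ← Complex.reCLM.integral_comp_comm hi,
    integral_map hX (by fun_prop)]
  refine integral_congr_ae (.of_forall fun ω => ?_)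
  simp only [Complex.reCLM_apply]
  rw [← Complex.ofReal_mul, Complex.exp_ofReal_mul_I_re]

/-- If the characteristic function of `X` vanishes at infinity, then rapid oscillations
`exp (i s X)` decorrelate from a slowly varying amplitude `K n X → A`: only the average `1 / 2`
of `cos ^ 2` survives in the variance. -/
lemma tendsto_variance_re_exp_mul {Ω : Type*} [MeasurableSpace Ω] {P : Measure Ω}
    [IsProbabilityMeasure P] {X : Ω → ℝ} (hX : AEMeasurable X P)
    (hcf : Tendsto (charFun (P.map X)) atTop (𝓝 0)) {s : ℕ → ℝ} (hs : Tendsto s atTop atTop)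
    {K : ℕ → ℝ → ℂ} (hK : ∀ n, Continuous (K n)) {B : ℝ} (hB : ∀ n x, ‖K n x‖ ≤ B) {A : ℝ}
    (hA : ∀ x, Tendsto (fun n => K n x) atTop (𝓝 (A : ℂ))) :
    Tendsto (fun n => Var[fun ω => (Complex.exp ((s n * X ω : ℝ) * Complex.I) * K n (X ω)).re; P])
      atTop (𝓝 (A ^ 2 / 2)) := by
  set T : ℕ → ℝ → ℝ := fun n x => (Complex.exp ((s n * x : ℝ) * Complex.I) * K n x).re with hT
  have hTc : ∀ n, Continuous (T n) := fun n => by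
    have := hK n
    fun_prop
  have hTm : ∀ n, AEStronglyMeasurable (fun ω => T n (X ω)) P := fun n =>
    ((hTc n).measurable.comp_aemeasurable hX).aestronglyMeasurable
  have hTB : ∀ n x, ‖T n x‖ ≤ B := fun n x => by
    refine (Complex.abs_re_le_norm _).trans ?_
    rw [norm_mul, Complex.norm_exp_ofReal_mul_I, one_mul]
    exact hB n x
  have hdiff : ∀ x, Tendsto (fun n => T n x - A * Real.cos (s n * x)) atTop (𝓝 0) := fun x => by
    have h0 : Tendsto (fun n => ‖K n x - A‖) atTop (𝓝 0) := by
      simpa using ((hA x).sub_const (A : ℂ)).norm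
    refine squeeze_zero_norm (fun n => ?_) h0
    have : T n x - A * Real.cos (s n * x)
        = (Complex.exp ((s n * x : ℝ) * Complex.I) * (K n x - A)).re := by
      rw [mul_sub, Complex.sub_re, Complex.re_mul_ofReal, Complex.exp_ofReal_mul_I_re, mul_comm A]
    rw [this]
    refine (Complex.abs_re_le_norm _).trans ?_
    rw [norm_mul, Complex.norm_exp_ofReal_mul_I, one_mul]
  have hcosB : ∀ n x, ‖A * Real.cos (s n * x)‖ ≤ |A| := fun n x => by
    rw [norm_mul, Real.norm_eq_abs, Real.norm_eq_abs]
    exact mul_le_of_le_one_right (abs_nonneg _) (Real.abs_cos_le_one _)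
  have hcosm : ∀ n, AEStronglyMeasurable (fun ω => A * Real.cos (s n * X ω)) P := fun n =>
    ((Real.measurable_cos.comp_aemeasurable (hX.const_mul _)).const_mul A).aestronglyMeasurable
  have hTi : ∀ n, Integrable (fun ω => T n (X ω)) P := fun n =>
    .of_bound (hTm n) B (.of_forall fun ω => hTB n _)
  have hci : ∀ n, Integrable (fun ω => A * Real.cos (s n * X ω)) P := fun n =>
    .of_bound (hcosm n) |A| (.of_forall fun ω => hcosB n _)
  have hT2i : ∀ n, Integrable (fun ω => T n (X ω) ^ 2) P := fun n =>
    .of_bound ((hTm n).pow 2) (B ^ 2) (.of_forall fun ω => by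
      rw [norm_pow]; exact pow_le_pow_left₀ (norm_nonneg _) (hTB n _) 2)
  have hc2i : ∀ n, Integrable (fun ω => (A * Real.cos (s n * X ω)) ^ 2) P := fun n =>
    .of_bound ((hcosm n).pow 2) (|A| ^ 2) (.of_forall fun ω => by
      rw [norm_pow]; exact pow_le_pow_left₀ (norm_nonneg _) (hcosB n _) 2)
  have hre : ∀ r : ℕ → ℝ, Tendsto r atTop atTop →
      Tendsto (fun n => ∫ ω, Real.cos (r n * X ω) ∂P) atTop (𝓝 0) := fun r hr => by
    simp_rw [integral_cos_eq_re_charFun hX]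
    exact (Complex.continuous_re.tendsto 0).comp (hcf.comp hr)
  have hmean : Tendsto (fun n => ∫ ω, T n (X ω) ∂P) atTop (𝓝 0) := by
    have h1 : Tendsto (fun n => ∫ ω, (T n (X ω) - A * Real.cos (s n * X ω)) ∂P) atTop
        (𝓝 (∫ _, (0 : ℝ) ∂P)) :=
      tendsto_integral_of_dominated_convergence (fun _ => B + |A|)
        (fun n => (hTm n).sub (hcosm n)) (integrable_const _)
        (fun n => .of_forall fun ω => (norm_sub_le _ _).trans (add_le_add (hTB n _) (hcosB n _)))
        (.of_forall fun ω => hdiff _)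
    have h2 := h1.add ((hre s hs).const_mul A)
    simp only [integral_zero, mul_zero, add_zero] at h2
    refine h2.congr fun n => ?_
    rw [integral_sub (hTi n) (hci n), integral_const_mul, sub_add_cancel]
  have hsq : Tendsto (fun n => ∫ ω, T n (X ω) ^ 2 ∂P) atTop (𝓝 (A ^ 2 / 2)) := by
    have h1 : Tendsto (fun n => ∫ ω, (T n (X ω) ^ 2 - (A * Real.cos (s n * X ω)) ^ 2) ∂P) atTop
        (𝓝 (∫ _, (0 : ℝ) ∂P)) := by
      refine tendsto_integral_of_dominated_convergence (fun _ => B ^ 2 + |A| ^ 2)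
        (fun n => ((hTm n).pow 2).sub ((hcosm n).pow 2)) (integrable_const _)
        (fun n => .of_forall fun ω => (norm_sub_le _ _).trans (add_le_add ?_ ?_))
        (.of_forall fun ω => ?_)
      · rw [norm_pow]; exact pow_le_pow_left₀ (norm_nonneg _) (hTB n _) 2
      · rw [norm_pow]; exact pow_le_pow_left₀ (norm_nonneg _) (hcosB n _) 2
      · refine squeeze_zero_norm (fun n => ?_)
          (a := fun n => (B + |A|) * ‖T n (X ω) - A * Real.cos (s n * X ω)‖)
          (by simpa using (hdiff (X ω)).norm.const_mul (B + |A|))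
        rw [sq_sub_sq, norm_mul]
        exact mul_le_mul_of_nonneg_right
          ((norm_add_le _ _).trans (add_le_add (hTB n _) (hcosB n _))) (norm_nonneg _)
    have h2 := h1.add ((hre (fun n => 2 * s n) (hs.const_mul_atTop two_pos)).const_mul
      (A ^ 2 / 2) |>.const_add (A ^ 2 / 2))
    simp only [integral_zero, mul_zero, add_zero, zero_add] at h2
    refine h2.congr fun n => ?_
    have hcos2 : ∫ ω, (A * Real.cos (s n * X ω)) ^ 2 ∂P
        = A ^ 2 / 2 + A ^ 2 / 2 * ∫ ω, Real.cos (2 * s n * X ω) ∂P := by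
      have hpt : ∀ ω, (A * Real.cos (s n * X ω)) ^ 2
          = A ^ 2 / 2 + A ^ 2 / 2 * Real.cos (2 * s n * X ω) := fun ω => by
        rw [mul_pow, Real.cos_sq, mul_assoc 2]; ring
      have hc : Integrable (fun ω => Real.cos (2 * s n * X ω)) P :=
        .of_bound (Real.measurable_cos.comp_aemeasurable (hX.const_mul _)).aestronglyMeasurable 1
          (.of_forall fun ω => Real.abs_cos_le_one _)
      simp_rw [hpt]
      rw [integral_add (integrable_const _) (hc.const_mul _), integral_const_mul]
      simp
    rw [integral_sub (hT2i n) (hc2i n), hcos2, sub_add_cancel]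
  have hfin := hsq.sub (hmean.pow 2)
  simp only [ne_eq, OfNat.ofNat_ne_zero, not_false_eq_true, zero_pow, sub_zero] at hfin
  refine hfin.congr fun n => ?_
  rw [variance_eq_sub (memLp_two_iff_integrable_sq (hTm n) |>.2 (hT2i n))]
  rfl

/-! ### The estimator as an average of transformed observations -/

section Estimator

variable {σ : ℝ} {φ : ℝ → ℂ}

/-- The integrand of the estimator for a single observation `x`. -/
noncomputable def deconvIntegrand (σ : ℝ) (φ : ℝ → ℂ) (g x t : ℝ) : ℂ :=
  Complex.exp (Complex.I * t * x) * φ (g * t) / (Real.exp (-(σ ^ 2 * t ^ 2 / 2)) : ℂ)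

lemma intervalIntegrable_deconvIntegrand (hφ : Integrable φ) {g : ℝ} (hg : 0 < g) (x a b : ℝ) :
    IntervalIntegrable (deconvIntegrand σ φ g x) volume a b := by
  have h1 : IntervalIntegrable (fun t => φ (g * t)) volume a b :=
    (hφ.comp_mul_left' hg.ne').intervalIntegrable
  have h2 : IntervalIntegrable (fun t : ℝ => (Complex.exp (Complex.I * t * x) /
      (Real.exp (-(σ ^ 2 * t ^ 2 / 2)) : ℂ)) * φ (g * t)) volume a b := by
    refine h1.continuousOn_mul (Continuous.continuousOn ?_)
    refine Continuous.div (by fun_prop) (by fun_prop) fun t => ?_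
    exact_mod_cast (Real.exp_pos _).ne'
  refine h2.congr fun t _ => ?_
  simp only [deconvIntegrand]
  ring

/-- Folding the integration range at the origin: Hermitian symmetry makes the integral real. -/
lemma integral_deconvIntegrand_symm (hφ : Integrable φ)
    (hsymm : ∀ᵐ t, φ (-t) = (starRingEnd ℂ) (φ t)) {g : ℝ} (hg : 0 < g) (x a : ℝ) :
    ∫ t in (-a)..a, deconvIntegrand σ φ g x t
      = ((2 * (∫ t in 0..a, deconvIntegrand σ φ g x t).re : ℝ) : ℂ) := by
  have hae : ∀ᵐ t : ℝ, φ (-(g * t)) = (starRingEnd ℂ) (φ (g * t)) :=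
    Measure.QuasiMeasurePreserving.ae (f := fun t => g * t) ⟨by fun_prop, by
      rw [Real.map_volume_mul_left hg.ne']
      exact Measure.smul_absolutelyContinuous⟩ hsymm
  have hneg : ∫ t in (-a)..0, deconvIntegrand σ φ g x t
      = (starRingEnd ℂ) (∫ t in 0..a, deconvIntegrand σ φ g x t) := by
    have h1 : ∫ t in 0..a, deconvIntegrand σ φ g x (-t)
        = ∫ t in (-a)..0, deconvIntegrand σ φ g x t := by
      rw [intervalIntegral.integral_comp_neg, neg_zero]
    have h2 : (starRingEnd ℂ) (∫ t in 0..a, deconvIntegrand σ φ g x t)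
        = ∫ t in 0..a, (starRingEnd ℂ) (deconvIntegrand σ φ g x t) := by
      simp only [intervalIntegral, map_sub, ← integral_conj]
    rw [← h1, h2]
    refine intervalIntegral.integral_congr_ae ?_
    filter_upwards [hae] with t ht _
    simp only [deconvIntegrand, map_mul, map_div₀, ← Complex.exp_conj, Complex.conj_ofReal,
      Complex.conj_I, mul_neg, ht]
    push_cast
    ring_nf
  rw [← intervalIntegral.integral_add_adjacent_intervals
    (intervalIntegrable_deconvIntegrand hφ hg x (-a) 0)
    (intervalIntegrable_deconvIntegrand hφ hg x 0 a), hneg, add_comm, Complex.add_conj]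

/-- The substitution `t = 1 / g - g * u` around the endpoint, where the exponent becomes
`σ ^ 2 / (2 * g ^ 2) - σ ^ 2 * u + σ ^ 2 * g ^ 2 * u ^ 2 / 2`. -/
lemma integral_deconvIntegrand_eq (α : ℝ) {g : ℝ} (hg : 0 < g) (x : ℝ) :
    ∫ t in 0..(1 / g), deconvIntegrand σ φ g x t
      = ((g * g ^ (2 * α) * Real.exp (σ ^ 2 / (2 * g ^ 2)) : ℝ) : ℂ) *
        (Complex.exp ((1 / g * x : ℝ) * Complex.I) * kernelFactor σ α φ g x) := by
  have hg2 : (0 : ℝ) ≤ 1 / g ^ 2 := by positivity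
  have hK : kernelFactor σ α φ g x = ∫ u in 0..(1 / g ^ 2),
      Complex.exp ((-(g * u * x) : ℝ) * Complex.I) *
        (φ (1 - g ^ 2 * u) / ((g ^ (2 * α) : ℝ) : ℂ)) *
        (Real.exp (-(σ ^ 2 * u) + σ ^ 2 * g ^ 2 * u ^ 2 / 2) : ℂ) := by
    rw [intervalIntegral.integral_of_le hg2, ← integral_indicator measurableSet_Ioc]
    rfl
  have hsub := intervalIntegral.integral_comp_sub_mul (a := 0) (b := 1 / g ^ 2)
    (deconvIntegrand σ φ g x) hg.ne' (1 / g)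
  rw [show 1 / g - g * (1 / g ^ 2) = 0 by field_simp; ring, mul_zero, sub_zero] at hsub
  have hsub' : ∫ t in 0..(1 / g), deconvIntegrand σ φ g x t
      = g * ∫ u in 0..(1 / g ^ 2), deconvIntegrand σ φ g x (1 / g - g * u) := by
    rw [hsub, Complex.real_smul, ← mul_assoc, ← Complex.ofReal_mul, mul_inv_cancel₀ hg.ne']
    simp
  have hpt : ∀ u, deconvIntegrand σ φ g x (1 / g - g * u)
      = ((g ^ (2 * α) * Real.exp (σ ^ 2 / (2 * g ^ 2)) : ℝ) : ℂ) *
        Complex.exp ((1 / g * x : ℝ) * Complex.I) *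
        (Complex.exp ((-(g * u * x) : ℝ) * Complex.I) *
        (φ (1 - g ^ 2 * u) / ((g ^ (2 * α) : ℝ) : ℂ)) *
        (Real.exp (-(σ ^ 2 * u) + σ ^ 2 * g ^ 2 * u ^ 2 / 2) : ℂ)) := fun u => by
    have hφarg : g * (1 / g - g * u) = 1 - g ^ 2 * u := by field_simp
    have hosc : Complex.exp (Complex.I * ((1 / g - g * u : ℝ) : ℂ) * x)
        = Complex.exp ((1 / g * x : ℝ) * Complex.I) *
          Complex.exp ((-(g * u * x) : ℝ) * Complex.I) := by
      rw [← Complex.exp_add]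
      congr 1
      push_cast
      ring
    have hgauss : (Real.exp (-(σ ^ 2 * (1 / g - g * u) ^ 2 / 2)))⁻¹
        = Real.exp (σ ^ 2 / (2 * g ^ 2)) *
          Real.exp (-(σ ^ 2 * u) + σ ^ 2 * g ^ 2 * u ^ 2 / 2) := by
      rw [← Real.exp_neg, ← Real.exp_add]
      congr 1
      field_simp
      ring
    have hgα : ((g ^ (2 * α) : ℝ) : ℂ) ≠ 0 := by
      exact_mod_cast (Real.rpow_pos_of_pos hg _).ne'
    rw [deconvIntegrand, hφarg, hosc, div_eq_mul_inv, ← Complex.ofReal_inv, hgauss,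
      Complex.ofReal_mul, Complex.ofReal_mul]
    field_simp
    push_cast
    ring
  simp_rw [hsub', hpt]
  rw [intervalIntegral.integral_const_mul, ← hK]
  push_cast
  ring

/-- The estimator is a real average of transforms of the single observations, scaled by the
deterministic factor `g ^ (2 + 2 * α) * exp (σ ^ 2 / (2 * g ^ 2))`. -/
lemma pEstimator_eq (hφ : Integrable φ) (hsymm : ∀ᵐ t, φ (-t) = (starRingEnd ℂ) (φ t)) (α : ℝ)
    {g : ℝ} (hg : 0 < g) (n : ℕ) (x : ℕ → ℝ) :
    pEstimator σ φ g n x = ((g ^ (2 + 2 * α) * Real.exp (σ ^ 2 / (2 * g ^ 2)) *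
      ((n : ℝ)⁻¹ * ∑ j ∈ Finset.range n,
        (Complex.exp ((1 / g * x j : ℝ) * Complex.I) * kernelFactor σ α φ g (x j)).re) : ℝ) :
        ℂ) := by
  have hpow : g ^ (2 + 2 * α) = g * (g * g ^ (2 * α)) := by
    rw [Real.rpow_add hg, Real.rpow_two]; ring
  have hint : ∫ t in (-(1 / g))..(1 / g),
      empiricalCharFun n x t * φ (g * t) / (Real.exp (-(σ ^ 2 * t ^ 2 / 2)) : ℂ)
      = (1 / (n : ℂ)) * ∑ j ∈ Finset.range n,
        ∫ t in (-(1 / g))..(1 / g), deconvIntegrand σ φ g (x j) t := by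
    rw [← intervalIntegral.integral_finsetSum
      fun j _ => intervalIntegrable_deconvIntegrand hφ hg (x j) _ _,
      ← intervalIntegral.integral_const_mul]
    refine intervalIntegral.integral_congr fun t _ => ?_
    simp only [empiricalCharFun, deconvIntegrand, Finset.mul_sum, Finset.sum_mul, Finset.sum_div]
    refine Finset.sum_congr rfl fun j _ => by ring
  rw [pEstimator, hint]
  simp_rw [integral_deconvIntegrand_symm hφ hsymm hg, integral_deconvIntegrand_eq α hg,
    Complex.re_ofReal_mul]
  rw [hpow]
  push_cast
  simp only [Finset.mul_sum]
  refine Finset.sum_congr rfl fun j _ => by ring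

end Estimator

end AtomicDeconvolution

/-! ### Asymptotic normality -/

theorem theorem2p4
    {Ω : Type*} [MeasurableSpace Ω] (P : Measure Ω) [IsProbabilityMeasure P]
    (p σ : ℝ) (f : ℝ → ℝ) (U V Z : ℕ → Ω → ℝ)
    (hmodel : AtomicDeconvolution.IsModel P p σ f U V Z)
    (hf : Integrable (AtomicDeconvolution.densityCharFun f) volume)
    (hX : ∀ i, Integrable (fun ω => AtomicDeconvolution.observation σ U V Z i ω ^ 2) P)
    (k : ℝ → ℝ) (φ_k : ℝ → ℂ)
    (hk : AtomicDeconvolution.IsFourierTransform k φ_k)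
    (hsupp : Function.support φ_k ⊆ Set.Icc (-1) 1)
    (hbdd : ∃ M : ℝ, ∀ t, ‖φ_k t‖ ≤ M)
    (hint : Integrable φ_k volume) (htwo : ∫ t, φ_k t = 2)
    (α C : ℝ) (hα : 0 ≤ α)
    (hC : (fun t : ℝ => φ_k (1 - t) - ((C * t ^ α : ℝ) : ℂ)) =o[𝓝[>] 0] fun t : ℝ => t ^ α)
    (g : ℕ → ℝ) (hgpos : ∀ n, 0 < g n) (hg : Tendsto g atTop (𝓝 0))
    (hrate : Tendsto (fun n : ℕ => g n ^ (4 + 4 * α) * Real.exp (σ ^ 2 / g n ^ 2) * (n : ℝ)⁻¹)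
      atTop (𝓝 0))
    (p_est : ℕ → Ω → ℂ)
    (hp_est : ∀ n ω, p_est n ω = AtomicDeconvolution.pEstimator σ φ_k (g n) n
      fun j => AtomicDeconvolution.observation σ U V Z j ω) :
    (∀ n ω, (p_est n ω).im = 0) ∧
    (∀ n, Integrable (p_est n) P) ∧
    TendstoInDistribution
      (fun (n : ℕ) (ω : Ω) =>
        √(n : ℝ) / (g n ^ (2 + 2 * α) * Real.exp (σ ^ 2 / (2 * g n ^ 2))) *
          (p_est n ω - ∫ ω', p_est n ω' ∂P).re)
      atTop (id : ℝ → ℝ) (fun _ => P)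
      (gaussianReal 0
        (C ^ 2 * Real.Gamma (1 + α) ^ 2 / 2 * (1 / σ ^ 2) ^ (2 + 2 * α)).toNNReal) := by
  obtain ⟨M, hM⟩ := hbdd
  have hσ := hmodel.sigma_pos
  obtain ⟨D, hD⟩ := AtomicDeconvolution.exists_norm_one_sub_le_mul_rpow hM hα hC
  have hsymm := hk.ae_neg_eq_conj hint.aestronglyMeasurable
  set X : ℕ → Ω → ℝ := AtomicDeconvolution.observation σ U V Z
  have hXm : ∀ i, AEMeasurable (X i) P := hmodel.aemeasurable_observation
  have hident : ∀ i, IdentDistrib (X i) (X 0) P P := hmodel.identDistrib_observation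
  set K : ℕ → ℝ → ℂ := fun n => AtomicDeconvolution.kernelFactor σ α φ_k (g n)
  set T : ℕ → ℝ → ℝ :=
    fun n x => (Complex.exp ((1 / g n * x : ℝ) * Complex.I) * K n x).re
  set r : ℕ → ℝ := fun n => g n ^ (2 + 2 * α) * Real.exp (σ ^ 2 / (2 * g n ^ 2))
  have hr : ∀ n, r n ≠ 0 := fun n =>
    (mul_pos (Real.rpow_pos_of_pos (hgpos n) _) (Real.exp_pos _)).ne'
  have hest : ∀ n ω, p_est n ω
      = ((r n * ((n : ℝ)⁻¹ * ∑ j ∈ Finset.range n, T n (X j ω)) : ℝ) : ℂ) :=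
    fun n ω => (hp_est n ω).trans
      (AtomicDeconvolution.pEstimator_eq hint hsymm α (hgpos n) n _)
  have hKc : ∀ n, Continuous (K n) := fun n =>
    AtomicDeconvolution.continuous_kernelFactor hσ hα hint hD (hgpos n)
  have hKB : ∀ n x, ‖K n x‖ ≤ _ := fun n x =>
    AtomicDeconvolution.norm_kernelFactor_le hσ hα hD (hgpos n) x
  have hTm : ∀ n, Measurable (T n) := fun n => by
    have := hKc n
    have hc : Continuous (T n) := by fun_prop
    exact hc.measurable
  have hTB : ∀ n x, |T n x| ≤ _ := fun n x => by
    refine (Complex.abs_re_le_norm _).trans (le_trans (le_of_eq ?_) (hKB n x))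
    rw [norm_mul, Complex.norm_exp_ofReal_mul_I, one_mul]
  have hTi : ∀ n j, Integrable (fun ω => T n (X j ω)) P := fun n j =>
    .of_bound ((hTm n).comp_aemeasurable (hXm j)).aestronglyMeasurable _
      (.of_forall fun ω => hTB n _)
  have havg : ∀ n, Integrable
      (fun ω => r n * ((n : ℝ)⁻¹ * ∑ j ∈ Finset.range n, T n (X j ω))) P := fun n =>
    ((integrable_finsetSum _ fun j _ => hTi n j).const_mul _).const_mul _
  have hmean : ∀ n, ∫ ω, p_est n ω ∂P
      = ((r n * ((n : ℝ)⁻¹ * (n * ∫ ω, T n (X 0 ω) ∂P)) : ℝ) : ℂ) := fun n => by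
    simp_rw [hest n]
    rw [integral_complex_ofReal, integral_const_mul, integral_const_mul,
      integral_finsetSum _ fun j _ => hTi n j]
    have hj : ∀ j, ∫ ω, T n (X j ω) ∂P = ∫ ω, T n (X 0 ω) ∂P :=
      fun j => ((hident j).comp (hTm n)).integral_eq
    simp [hj]
  refine ⟨fun n ω => by rw [hest]; exact Complex.ofReal_im _, fun n => ?_, ?_⟩
  · rw [funext (hest n)]
    exact (havg n).ofReal
  have hs : Tendsto (fun n => 1 / g n) atTop atTop := by
    simp_rw [one_div]
    exact (tendsto_nhdsWithin_iff.2 ⟨hg, .of_forall hgpos⟩ :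
      Tendsto g atTop (𝓝[>] 0)).inv_tendsto_nhdsGT_zero
  have hvar := AtomicDeconvolution.tendsto_variance_re_exp_mul (hXm 0)
    hmodel.tendsto_charFun_observation hs hKc hKB
    (AtomicDeconvolution.tendsto_kernelFactor hσ hα hint hD hC hgpos hg)
  have hclt := AtomicDeconvolution.tendstoInDistribution_inv_sqrt_mul_sum_of_bounded
    hmodel.indep_X hident hTm hTB hvar
  have hv : (C * ((1 / σ ^ 2) ^ (1 + α) * Real.Gamma (1 + α))) ^ 2 / 2
      = C ^ 2 * Real.Gamma (1 + α) ^ 2 / 2 * (1 / σ ^ 2) ^ (2 + 2 * α) := by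
    have hpos : 0 < 1 / σ ^ 2 := by positivity
    have hsq : (1 / σ ^ 2) ^ (2 + 2 * α) = ((1 / σ ^ 2) ^ (1 + α)) ^ 2 := by
      rw [sq ((1 / σ ^ 2) ^ (1 + α)), ← Real.rpow_add hpos]
      congr 1
      ring
    rw [hsq]
    ring
  rw [hv] at hclt
  have hfun : (fun (n : ℕ) (ω : Ω) =>
        √(n : ℝ) / (g n ^ (2 + 2 * α) * Real.exp (σ ^ 2 / (2 * g n ^ 2))) *
          (p_est n ω - ∫ ω', p_est n ω' ∂P).re)
      = fun (n : ℕ) ω => (√(n : ℝ))⁻¹ * ∑ j ∈ Finset.range n,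
        (T n (X j ω) - ∫ ω', T n (X 0 ω') ∂P) := by
    funext n ω
    change √(n : ℝ) / r n * _ = _
    rw [hmean, hest, ← Complex.ofReal_sub, Complex.ofReal_re, Finset.sum_sub_distrib,
      Finset.sum_const, Finset.card_range, nsmul_eq_mul, ← mul_sub, ← mul_sub]
    -- This also holds for `n = 0`, where both sides are `0` by the conventions for `0⁻¹`.
    have hsqrt : √(n : ℝ) * (n : ℝ)⁻¹ = (√(n : ℝ))⁻¹ := by
      rw [← div_eq_mul_inv, Real.sqrt_div_self]
    rw [← hsqrt]
    field_simp [hr n]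
  rw [hfun]
  exact hclt
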